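/- Let $r\ge 1$ be an integer. A ($\mathbb{C}$-linear) subspace $W\subseteq\mathbb{C}(z)^r$ is called \emph{fat} if $p\,\mathbb{C}[z]^r\subseteq W\subseteq q^{-1}\mathbb{C}[z]^r$ for some nonzero polynomials $p,q\in\mathbb{C}[z]$. For $\lambda\in\mathbb{C}$, a subspace $U\subseteq\mathbb{C}[z]^r$ is \emph{$\lambda$-primary} if $(z-\lambda)^N\mathbb{C}[z]^r\subseteq U$ for some $N\ge 0$; a subspace of $\mathbb{C}[z]^r$ is \emph{primary decomposable} if it is an intersection (inside $\mathbb{C}[z]^r$) of finitely many subspaces, each of which is $\lambda$-primary for some $\lambda\in\mathbb{C}$. Let $\mathrm{GRad}$ be the set of primary decomposable fat subspaces of $\mathbb{C}(z)^r$, that is, of the fat subspaces of the form $q^{-1}V$ with $q$ a nonzero polynomial and $V\subseteq\mathbb{C}[z]^r$ primary decomposable. For $W\in\mathrm{GRad}$ let $M_W\subseteq\mathbb{C}(z)[\partial_z]^r$ be the space of all $D=(D_1,\dots,D_r)$ such that $(D_1.p,\dots,D_r.p)\in W$ for every polynomial $p\in\mathbb{C}[z]$, and let $L_W\subseteq\mathbb{C}(z)^r$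 be the space of all leading coefficients of elements of $M_W$, where the leading coefficient of $D=\sum_{k\le n}c_k\partial_z^k$ ($c_k\in\mathbb{C}(z)^r$, $c_n\ne 0$) is $c_n$, and that of $D=0$ is $0$. The adelic Grassmannian $\mathrm{Gr}^{\mathrm{ad}}$ is the set of all $W\in\mathrm{GRad}$ with $L_W=\mathbb{C}[z]^r$. Then: (i) if $W\in\mathrm{GRad}$ satisfies $zW\subseteq W$, then $W=L_W$; (ii) $\mathbb{C}[z]^r$ is a point of $\mathrm{Gr}^{\mathrm{ad}}$ with $z\,\mathbb{C}[z]^r\subseteq\mathbb{C}[z]^r$, and it is the only point $W$ of $\mathrm{Gr}^{\mathrm{ad}}$ such that $zW\subseteq W$. -/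

import Mathlib

open scoped Polynomial

namespace AdelicGrassmannian

noncomputable section

/-! The derivation `∂_z` of the field `ℂ(z)` of rational functions, by the quotient rule. -/

/-- The formal derivative `f'` of a rational function `f = p / q`, namely `(p' q - p q') / q ^ 2`. -/
def ratDeriv (f : RatFunc ℂ) : RatFunc ℂ :=
  (algebraMap ℂ[X] (RatFunc ℂ) (Polynomial.derivative f.num * f.denom
    - f.num * Polynomial.derivative f.denom)) / (algebraMap ℂ[X] (RatFunc ℂ) f.denom) ^ 2

theorem algebraMap_ne_zero {q : ℂ[X]} (hq : q ≠ 0) : algebraMap ℂ[X] (RatFunc ℂ) q ≠ 0 :=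
  RatFunc.algebraMap_ne_zero hq

theorem quotient_aux {R : Type*} [CommRing R] {n d p q n' d' p' q' : R} (h1 : n * q = p * d)
    (h3 : n' * q + n * q' = p' * d + p * d') :
    (n' * d - n * d') * q ^ 2 = (p' * q - p * q') * d ^ 2 := by
  linear_combination (q * d) * h3 - (q * d' + q' * d) * h1

/-- The quotient rule holds for every presentation of a rational function as a fraction. -/
theorem ratDeriv_div (p q : ℂ[X]) (hq : q ≠ 0) :
    ratDeriv (algebraMap ℂ[X] (RatFunc ℂ) p / algebraMap ℂ[X] (RatFunc ℂ) q) =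
      (algebraMap ℂ[X] (RatFunc ℂ) (Polynomial.derivative p * q
        - p * Polynomial.derivative q)) / (algebraMap ℂ[X] (RatFunc ℂ) q) ^ 2 := by
  set f : RatFunc ℂ := algebraMap ℂ[X] (RatFunc ℂ) p / algebraMap ℂ[X] (RatFunc ℂ) q with hf
  have hd : f.denom ≠ 0 := f.denom_ne_zero
  have hq' := algebraMap_ne_zero hq
  have hd' := algebraMap_ne_zero hd
  have h1 : f.num * q = p * f.denom := by
    apply RatFunc.algebraMap_injective ℂ
    have h2 : algebraMap ℂ[X] (RatFunc ℂ) f.num / algebraMap ℂ[X] (RatFunc ℂ) f.denom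
        = algebraMap ℂ[X] (RatFunc ℂ) p / algebraMap ℂ[X] (RatFunc ℂ) q := by
      rw [RatFunc.num_div_denom]
    rw [div_eq_div_iff hd' hq'] at h2
    simpa only [map_mul] using h2
  have h3 := congrArg Polynomial.derivative h1
  simp only [Polynomial.derivative_mul] at h3
  unfold ratDeriv
  rw [div_eq_div_iff (pow_ne_zero 2 hd') (pow_ne_zero 2 hq')]
  rw [← map_pow, ← map_pow, ← map_mul, ← map_mul]
  exact congrArg _ (quotient_aux h1 h3)

/-- The derivation `∂_z`, as a `ℂ`-linear endomorphism of `ℂ(z)`. -/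
def ratDerivLin : Module.End ℂ (RatFunc ℂ) where
  toFun := ratDeriv
  map_add' f g := by
    have hf := f.denom_ne_zero
    have hg := g.denom_ne_zero
    have hf' := algebraMap_ne_zero hf
    have hg' := algebraMap_ne_zero hg
    have h : f + g = algebraMap ℂ[X] (RatFunc ℂ) (f.num * g.denom + f.denom * g.num) /
        algebraMap ℂ[X] (RatFunc ℂ) (f.denom * g.denom) := by
      conv_lhs => rw [← RatFunc.num_div_denom f, ← RatFunc.num_div_denom g]
      rw [div_add_div _ _ hf' hg']
      simp only [map_mul, map_add]
    rw [h, ratDeriv_div _ _ (mul_ne_zero hf hg)]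
    unfold ratDeriv
    simp only [Polynomial.derivative_mul, map_add, map_sub, map_mul]
    field_simp
    ring
  map_smul' c f := by
    have hf := f.denom_ne_zero
    have h : c • f = algebraMap ℂ[X] (RatFunc ℂ) (Polynomial.C c * f.num) /
        algebraMap ℂ[X] (RatFunc ℂ) f.denom := by
      conv_lhs => rw [← RatFunc.num_div_denom f]
      rw [map_mul, mul_div_assoc, RatFunc.algebraMap_C, RatFunc.smul_eq_C_mul]
    have h2 : ∀ g : RatFunc ℂ, c • g = algebraMap ℂ[X] (RatFunc ℂ) (Polynomial.C c) * g := by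
      intro g
      rw [RatFunc.algebraMap_C, RatFunc.smul_eq_C_mul]
    rw [h, ratDeriv_div _ _ hf, RingHom.id_apply, h2]
    unfold ratDeriv
    simp only [Polynomial.derivative_mul, Polynomial.derivative_C, map_sub, map_mul, zero_mul,
      zero_add]
    ring

/-- Multiplication by a rational function, as a `ℂ`-linear endomorphism of `ℂ(z)`. -/
def mulOp (a : RatFunc ℂ) : Module.End ℂ (RatFunc ℂ) := LinearMap.mulLeft ℂ a

/-- The ring `ℂ(z)[∂_z]` of differential operators with rational coefficients: the algebra of
endomorphisms of `ℂ(z)` generated by `∂_z` and the multiplications by rational functions. -/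
def RatDiffOp : Subalgebra ℂ (Module.End ℂ (RatFunc ℂ)) :=
  Algebra.adjoin ℂ (Set.range mulOp ∪ {ratDerivLin})

/-- The space `ℂ(z)^r` of row vectors of rational functions. -/
abbrev RatVec (r : ℕ) : Type := Fin r → RatFunc ℂ

/-- The subspace `ℂ[z]^r` of `ℂ(z)^r`. -/
def polyVec (r : ℕ) : Submodule ℂ (RatVec r) where
  carrier := {f | ∀ i, ∃ p : ℂ[X], f i = algebraMap ℂ[X] (RatFunc ℂ) p}
  add_mem' := by
    intro f g hf hg i
    obtain ⟨p, hp⟩ := hf i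
    obtain ⟨q, hq⟩ := hg i
    exact ⟨p + q, by rw [Pi.add_apply, hp, hq, map_add]⟩
  zero_mem' := fun _ => ⟨0, by simp⟩
  smul_mem' := by
    intro c f hf i
    obtain ⟨p, hp⟩ := hf i
    exact ⟨Polynomial.C c * p, by
      rw [Pi.smul_apply, hp, map_mul, RatFunc.algebraMap_C, RatFunc.smul_eq_C_mul]⟩

/-- A subspace `W` of `ℂ(z)^r` is fat if `p ℂ[z]^r ⊆ W ⊆ q⁻¹ ℂ[z]^r` for some nonzero
polynomials `p` and `q`. -/
def IsFat {r : ℕ} (W : Submodule ℂ (RatVec r)) : Prop :=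
  ∃ p q : ℂ[X], p ≠ 0 ∧ q ≠ 0 ∧ (∀ f ∈ polyVec r, p • f ∈ W) ∧ ∀ f ∈ W, q • f ∈ polyVec r

/-- A subspace `U` of `ℂ[z]^r` is `a`-primary if `(z - a)^N ℂ[z]^r ⊆ U` for some `N`. -/
def IsPrimary {r : ℕ} (a : ℂ) (U : Submodule ℂ (RatVec r)) : Prop :=
  U ≤ polyVec r ∧
    ∃ N : ℕ, ∀ f ∈ polyVec r, ((Polynomial.X - Polynomial.C a) ^ N : ℂ[X]) • f ∈ U

/-- A subspace of `ℂ[z]^r` is primary decomposable if it is an intersection, inside `ℂ[z]^r`, of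
finitely many subspaces that are primary with respect to points of `ℂ`. -/
def IsPolyPrimaryDecomposable {r : ℕ} (V : Submodule ℂ (RatVec r)) : Prop :=
  ∃ (s : Finset ℂ) (U : ℂ → Submodule ℂ (RatVec r)),
    (∀ a ∈ s, IsPrimary a (U a)) ∧ V = polyVec r ⊓ ⨅ a ∈ s, U a

/-- `GRad r` is the set of primary decomposable fat subspaces of `ℂ(z)^r`, that is, of the fat
subspaces of the form `q⁻¹ V` with `q` a nonzero polynomial and `V` a primary decomposable
subspace of `ℂ[z]^r`. -/
def GRad (r : ℕ) : Set (Submodule ℂ (RatVec r)) :=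
  {W | IsFat W ∧ ∃ (q : ℂ[X]) (V : Submodule ℂ (RatVec r)), q ≠ 0 ∧
    IsPolyPrimaryDecomposable V ∧ ∀ f : RatVec r, f ∈ W ↔ q • f ∈ V}

/-- The space `M_W` of all `D = (D_1, …, D_r)` in `ℂ(z)[∂_z]^r` such that `D.ℂ[z] ⊆ W`. -/
def opModule {r : ℕ} (W : Submodule ℂ (RatVec r)) : Submodule ℂ (Fin r → RatDiffOp) where
  carrier := {D | ∀ p : ℂ[X],
    (fun i => (D i : Module.End ℂ (RatFunc ℂ)) (algebraMap ℂ[X] (RatFunc ℂ) p)) ∈ W}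
  add_mem' := fun hD hE p => W.add_mem (hD p) (hE p)
  zero_mem' := fun _ => W.zero_mem
  smul_mem' := fun c _ hD p => W.smul_mem c (hD p)

/-- The vector `a` in `ℂ(z)^r` is the leading coefficient of `D` in `ℂ(z)[∂_z]^r`: either
`D = ∑_{k ≤ n} c_k ∂_z ^ k` with `c_k` in `ℂ(z)^r` and `c_n = a ≠ 0`, or `D = 0` and `a = 0`. -/
def IsLeadingCoeff {r : ℕ} (D : Fin r → RatDiffOp) (a : RatVec r) : Prop :=
  (D = 0 ∧ a = 0) ∨ ∃ (n : ℕ) (c : ℕ → RatVec r), c n = a ∧ a ≠ 0 ∧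
    ∀ i, (D i : Module.End ℂ (RatFunc ℂ)) =
      ∑ k ∈ Finset.range (n + 1), mulOp (c k i) * ratDerivLin ^ k

/-- The space `L_W` of all leading coefficients of the operators in `M_W`. -/
def leadingCoeffs {r : ℕ} (W : Submodule ℂ (RatVec r)) : Set (RatVec r) :=
  {a | ∃ D ∈ opModule W, IsLeadingCoeff D a}

/-- The adelic Grassmannian: the set of all `W` in `GRad r` such that `L_W = ℂ[z]^r`. -/
def Grad (r : ℕ) : Set (Submodule ℂ (RatVec r)) :=
  {W | W ∈ GRad r ∧ leadingCoeffs W = (polyVec r : Set (RatVec r))}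

/-- The condition `z W ⊆ W`. -/
def ZStable {r : ℕ} (W : Submodule ℂ (RatVec r)) : Prop :=
  ∀ f ∈ W, (RatFunc.X : RatFunc ℂ) • f ∈ W

end

end AdelicGrassmannian

namespace AdelicGrassmannian

open Polynomial

/-! If `W` is stable under `z`, it is a `ℂ[z]`-module, so for `a ∈ W` the order-zero operator `p ↦ p
a` lies in `M_W` and has leading coefficient `a`. Conversely, if `D ∈ M_W` has order `n ≥ 1` and
leading coefficient `c`, the commutator `D z - z D` again maps `ℂ[z]` into `W`, with order `n - 1`
and leading coefficient `n c`; iterating gives `n! c ∈ W`, hence `c ∈ W` (`ZStable.topCoeff_mem`).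
So `W = L_W`, and on the adelic Grassmannian `L_W` is `ℂ[z]^r`. -/

theorem ratDerivLin_algebraMap (p : ℂ[X]) :
    ratDerivLin (algebraMap ℂ[X] (RatFunc ℂ) p) =
      algebraMap ℂ[X] (RatFunc ℂ) (derivative p) := by
  have h := ratDeriv_div p 1 one_ne_zero
  simpa [ratDerivLin] using h

theorem ratDerivLin_pow_algebraMap (k : ℕ) (p : ℂ[X]) :
    (ratDerivLin ^ k) (algebraMap ℂ[X] (RatFunc ℂ) p) =
      algebraMap ℂ[X] (RatFunc ℂ) (derivative^[k] p) := by
  induction k with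
  | zero => simp
  | succ k ih =>
    rw [pow_succ', Module.End.mul_apply, ih, ratDerivLin_algebraMap,
      Function.iterate_succ_apply']

/-- The top coefficient of a differential operator mapping `ℂ[z]` into a `z`-stable subspace
lies in that subspace: take iterated commutators with `z`. -/
theorem ZStable.topCoeff_mem {r : ℕ} {W : Submodule ℂ (RatVec r)} (hW : ZStable W) (n : ℕ) :
    ∀ c : ℕ → RatVec r,
      (∀ p : ℂ[X], ∑ k ∈ Finset.range (n + 1),
        algebraMap ℂ[X] (RatFunc ℂ) (derivative^[k] p) • c k ∈ W) → c n ∈ W := by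
  induction n with
  | zero =>
    intro c hc
    simpa using hc 1
  | succ n ih =>
    intro c hc
    have hn : ((n : ℂ) + 1) ≠ 0 := Nat.cast_add_one_ne_zero n
    suffices h : ((n : ℂ) + 1) • c (n + 1) ∈ W from (W.smul_mem_iff hn).1 h
    -- These are the coefficients of `D z - z D`, since `∂^(k+1) z - z ∂^(k+1) = (k+1) ∂^k`.
    refine ih (fun k => ((k : ℂ) + 1) • c (k + 1)) fun p => ?_
    have h := W.sub_mem (hc (X * p)) (hW _ (hc p))
    convert h using 1
    rw [Finset.smul_sum, ← Finset.sum_sub_distrib, Finset.sum_range_succ' _ (n + 1)]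
    -- The order-zero term commutes with `z`, so it drops out and the index shifts by one.
    have h0 : algebraMap ℂ[X] (RatFunc ℂ) (derivative^[0] (X * p)) • c 0 -
        (RatFunc.X : RatFunc ℂ) • algebraMap ℂ[X] (RatFunc ℂ) (derivative^[0] p) • c 0 = 0 := by
      rw [smul_smul]
      simp
    rw [h0, add_zero]
    refine Finset.sum_congr rfl fun k _ => ?_
    have hX : derivative^[k + 1] (X * p) =
        X * derivative^[k + 1] p + C ((k : ℂ) + 1) * derivative^[k] p := by
      rw [mul_comm X p, iterate_derivative_mul_X]
      simp [mul_comm, nsmul_eq_mul]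
    rw [hX, smul_smul, ← sub_smul, map_add, map_mul, map_mul, RatFunc.algebraMap_X,
      add_sub_cancel_left, RatFunc.algebraMap_C]
    ext i
    simp only [Pi.smul_apply, smul_eq_mul, RatFunc.smul_eq_C_mul]
    ring

theorem ZStable.algebraMap_smul_mem {r : ℕ} {W : Submodule ℂ (RatVec r)} (hW : ZStable W)
    (p : ℂ[X]) {f : RatVec r} (hf : f ∈ W) : algebraMap ℂ[X] (RatFunc ℂ) p • f ∈ W := by
  induction p using Polynomial.induction_on' with
  | add p q hp hq => simpa only [map_add, add_smul] using W.add_mem hp hq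
  | monomial n a =>
    induction n generalizing a with
    | zero =>
      convert W.smul_mem a hf using 1
      ext i
      simp [RatFunc.smul_eq_C_mul, RatFunc.algebraMap_C]
    | succ n ih =>
      have h := hW _ (ih a)
      rwa [smul_smul, ← RatFunc.algebraMap_X, ← map_mul, X_mul_monomial] at h

theorem mulOp_mem_ratDiffOp (a : RatFunc ℂ) : mulOp a ∈ RatDiffOp :=
  Algebra.subset_adjoin (Or.inl ⟨a, rfl⟩)

theorem ZStable.coe_eq_leadingCoeffs {r : ℕ} {W : Submodule ℂ (RatVec r)} (hW : ZStable W) :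
    (W : Set (RatVec r)) = leadingCoeffs W := by
  ext a
  constructor
  · intro ha
    refine ⟨fun i => ⟨mulOp (a i), mulOp_mem_ratDiffOp _⟩, fun p => ?_, ?_⟩
    · convert hW.algebraMap_smul_mem p ha using 1
      ext i
      simp [mulOp, mul_comm]
    -- The zero vector is a leading coefficient only through `D = 0`.
    · by_cases h0 : a = 0
      · refine Or.inl ⟨?_, h0⟩
        ext i : 2
        simp [h0, mulOp]
      · exact Or.inr ⟨0, fun _ => a, rfl, h0, fun i => by simp⟩
  · rintro ⟨D, hD, ⟨-, rfl⟩ | ⟨n, c, rfl, -, hc⟩⟩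
    · exact W.zero_mem
    · refine hW.topCoeff_mem n c fun p => ?_
      convert hD p using 1
      ext i
      rw [hc i]
      simp only [mulOp, LinearMap.sum_apply, Finset.sum_apply, Pi.smul_apply, smul_eq_mul,
        Module.End.mul_apply, LinearMap.mulLeft_apply, ratDerivLin_pow_algebraMap, mul_comm]

theorem zStable_polyVec (r : ℕ) : ZStable (polyVec r) := by
  intro f hf i
  obtain ⟨p, hp⟩ := hf i
  exact ⟨X * p, by rw [Pi.smul_apply, hp, map_mul, RatFunc.algebraMap_X, smul_eq_mul]⟩

theorem polyVec_mem_GRad (r : ℕ) : polyVec r ∈ GRad r := by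
  -- All denominators are `1`, and `ℂ[z]^r` is the intersection of the empty family of primary
  -- subspaces.
  refine ⟨⟨1, 1, one_ne_zero, one_ne_zero, fun f hf => ?_, fun f hf => ?_⟩,
    1, polyVec r, one_ne_zero, ⟨∅, fun _ => ⊤, ?_, ?_⟩, fun f => ?_⟩ <;> simp_all

theorem polyVec_mem_Grad (r : ℕ) : polyVec r ∈ Grad r :=
  ⟨polyVec_mem_GRad r, (zStable_polyVec r).coe_eq_leadingCoeffs.symm⟩

end AdelicGrassmannian

theorem mainTheorem9 (r : ℕ) (hr : 1 ≤ r) :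
    (∀ W ∈ AdelicGrassmannian.GRad r, AdelicGrassmannian.ZStable W →
      (W : Set (AdelicGrassmannian.RatVec r)) = AdelicGrassmannian.leadingCoeffs W) ∧
    ∀ W : Submodule ℂ (AdelicGrassmannian.RatVec r),
      (W ∈ AdelicGrassmannian.Grad r ∧ AdelicGrassmannian.ZStable W) ↔
        W = AdelicGrassmannian.polyVec r := by
  refine ⟨fun W _ hW => hW.coe_eq_leadingCoeffs, fun W => ⟨fun ⟨hW, hz⟩ => ?_, ?_⟩⟩
  -- Both `W` and `ℂ[z]^r` equal `L_W`.
  · exact SetLike.coe_injective (hz.coe_eq_leadingCoeffs.trans hW.2)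
  · rintro rfl
    exact ⟨AdelicGrassmannian.polyVec_mem_Grad r, AdelicGrassmannian.zStable_polyVec r⟩
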